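/- Let $\Omega_s,\Omega_f\subset\mathbb R^d$ ($d\ge 1$) be bounded open sets with Lipschitz boundary (the solid and the fluid domain), let $\Sigma=\partial\Omega_s\cap\partial\Omega_f$ and $\Sigma_i=\partial\Omega_i\setminus\Sigma$ for $i=s,f$, and let $n_s,n$ be the outward normals of $\Omega_s,\Omega_f$. Let $\rho_s,\rho_f,\mu,L_1,\lambda,\Delta t>0$, $L_2\ge 0$, $N\in\mathbb N$, and $t_n=n\,\Delta t$. Write $\varepsilon$ for the symmetric gradient and $V_i$ for the space of vector fields in $H^1(\Omega_i)$ whose trace vanishes on $\Sigma_i$. Initial data are $\eta^0(t_0)\in V_s$, $\dot\eta^0(t_0)\in L^2(\Omega_s)$, $u^0(t_0)\in V_f$ and an initial fluid traction $\sigma_f^0(t_0)n\in L^2(\Sigma)$. On $\Sigma$ set $\tilde u^0=u^0(t_0)$, $\tilde\sigma_f^0n=\sigma_f^0(t_0)n$, and for $n\ge1$ $$\tilde u^n=\frac1{\Delta t}\int_{t_{n-1}}^{t_n}u^n(s)\,ds,\qquad \tilde\sigma_f^n n=\frac1{\Delta t}\int_{t_{n-1}}^{t_n}\sigma_f^n(s)n\,ds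 .$$ Suppose that for every $0\le n\le N-1$, on the time slab $[t_n,t_{n+1}]$: (solid) $\eta^{n+1}\in C([t_n,t_{n+1}];V_s)$ and $\dot\eta^{n+1}=\partial_t\eta^{n+1}\in C([t_n,t_{n+1}];L^2(\Omega_s))$ form a weak solution of $$\rho_s\partial_t\dot\eta^{n+1}-\operatorname{div}\sigma_s^{n+1}=0\ \text{ in }\Omega_s,\qquad \sigma_s^{n+1}=2L_1\varepsilon(\eta^{n+1})+L_2(\operatorname{div}\eta^{n+1})I,$$ $$\eta^{n+1}=0\ \text{ on }\Sigma_s,\qquad \lambda\dot\eta^{n+1}+\sigma_s^{n+1}n_s=\lambda\tilde u^n-\tilde\sigma_f^n n\ \text{ on }\Sigma,$$ with $\eta^{n+1}(t_n)=\eta^n(t_n)$, $\dot\eta^{n+1}(t_n)=\dot\eta^n(t_n)$, where the velocity $\dot\eta^{n+1}|_\Sigma$ (the weak time derivative of the trace of $\eta^{n+1}$) and the traction $\sigma_s^{n+1}n_s$ belong to $L^2(t_n,t_{n+1};L^2(\Sigma))$; (fluid) $u^{n+1}\in C([t_n,t_{n+1}];L^2(\Omega_f))\cap L^2(t_n,t_{n+1};V_f)$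 and $p^{n+1}\in L^1(t_n,t_{n+1};L^2(\Omega_f))$ form a weak solution of $$\rho_f\partial_tu^{n+1}-\operatorname{div}\sigma_f^{n+1}=0,\quad \operatorname{div}u^{n+1}=0\ \text{ in }\Omega_f,\qquad \sigma_f^{n+1}=2\mu\,\varepsilon(u^{n+1})-p^{n+1}I,$$ $$u^{n+1}=0\ \text{ on }\Sigma_f,\qquad \lambda u^{n+1}+\sigma_f^{n+1}n=\lambda\dot\eta^{n+1}+\tilde\sigma_f^n n\ \text{ on }\Sigma,$$ with $u^{n+1}(t_n)=u^n(t_n)$, where the traction $\sigma_f^{n+1}n$ belongs to $L^2(t_n,t_{n+1};L^2(\Sigma))$. Here the momentum equations and the tractions are understood through Green's formula: for all $w\in V_f$ and $t\in[t_n,t_{n+1}]$, $$\rho_f\,(u^{n+1}(t)-u^{n+1}(t_n),w)_{L^2(\Omega_f)}+\int_{t_n}^t(\sigma_f^{n+1},\nabla w)_{L^2(\Omega_f)}\,ds=\int_{t_n}^t\int_\Sigma\sigma_f^{n+1}n\cdot w\,ds,$$ and in the same way for the solid, with $\rho_s$, $\dot\eta^{n+1}$, $\sigma_s^{n+1}$,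 $n_s$ and $w\in V_s$. Put $\|w\|_S^2=2L_1\|\varepsilon(w)\|_{L^2(\Omega_s)}^2+L_2\|\operatorname{div}w\|_{L^2(\Omega_s)}^2$ and $$E^n=\frac{\rho_f}2\|u^n(t_n)\|_{L^2(\Omega_f)}^2+\frac{\rho_s}2\|\dot\eta^n(t_n)\|_{L^2(\Omega_s)}^2+\frac12\|\eta^n(t_n)\|_S^2\qquad(n\ge0),$$ $$T^n=2\mu\int_{t_{n-1}}^{t_n}\|\varepsilon(u^n)\|_{L^2(\Omega_f)}^2ds+\frac\lambda2\int_{t_{n-1}}^{t_n}\|\dot\eta^n-\tilde u^{n-1}\|_{L^2(\Sigma)}^2ds\qquad(n\ge1),$$ $$S^n=\frac1{2\lambda}\int_{t_{n-1}}^{t_n}\|\sigma_f^nn\|_{L^2(\Sigma)}^2ds+\frac\lambda2\int_{t_{n-1}}^{t_n}\|u^n\|_{L^2(\Sigma)}^2ds\quad(n\ge1),\qquad S^0=\frac{\Delta t}{2\lambda}\|\sigma_f^0(t_0)n\|_{L^2(\Sigma)}^2+\frac{\lambda\Delta t}2\|u^0(t_0)\|_{L^2(\Sigma)}^2 .$$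 Then $$E^N+\sum_{n=1}^NT^n+S^N\le E^0+S^0 .$$ -/

import Mathlib

open MeasureTheory Set
open scoped ContDiff

namespace RobinFSI

noncomputable section

/-! ### Vectors, tensors and domains -/

/-- Points and vectors of `ℝᵈ`. -/
abbrev Vec (d : ℕ) := EuclideanSpace ℝ (Fin d)

/-- `d × d` tensors with the Frobenius inner product; the entry `(i, j)` of a gradient
is `∂ⱼ uᵢ`. -/
abbrev Tensor (d : ℕ) := EuclideanSpace ℝ (Fin d × Fin d)

/-- The symmetric part `(G + Gᵀ) / 2`. -/
def symPart (d : ℕ) : Tensor d →L[ℝ] Tensor d :=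
  LinearMap.toContinuousLinearMap
    { toFun := fun G => WithLp.toLp 2 (fun ij => (G (ij.1, ij.2) + G (ij.2, ij.1)) / 2)
      map_add' := fun G H => by ext ij; simp; ring
      map_smul' := fun c G => by ext ij; simp; ring }

/-- The trace `∑ᵢ Gᵢᵢ`. -/
def tr (d : ℕ) : Tensor d →L[ℝ] ℝ :=
  LinearMap.toContinuousLinearMap
    { toFun := fun G => ∑ i, G (i, i)
      map_add' := fun G H => by simp [Finset.sum_add_distrib]
      map_smul' := fun c G => by simp [Finset.mul_sum] }

/-- The isotropic tensor `q I`. -/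
def iso (d : ℕ) : ℝ →L[ℝ] Tensor d :=
  LinearMap.toContinuousLinearMap
    { toFun := fun q => WithLp.toLp 2 (fun ij => if ij.1 = ij.2 then q else 0)
      map_add' := fun p q => by ext ij; by_cases h : ij.1 = ij.2 <;> simp [h]
      map_smul' := fun c q => by ext ij; by_cases h : ij.1 = ij.2 <;> simp [h] }

/-- A bounded open set with Lipschitz boundary: near every boundary point, and after a choice of
the "vertical" direction `e`, the set is the part of a ball above the graph of a Lipschitz
function of the component orthogonal to `e`. -/
structure IsLipschitzDomain {d : ℕ} (Ω : Set (Vec d)) : Prop where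
  isOpen : IsOpen Ω
  isBounded : Bornology.IsBounded Ω
  lipschitz : ∀ x ∈ frontier Ω, ∃ r > 0, ∃ e : Vec d, ‖e‖ = 1 ∧
    ∃ (K : NNReal) (f : Vec d → ℝ), LipschitzWith K f ∧
      ∀ y ∈ Metric.ball x r, y ∈ Ω ↔ f (y - inner ℝ e y • e) < inner ℝ e y

/-- The interface `∂Ωₛ ∩ ∂Ω_f`. -/
def interface {d : ℕ} (Ωs Ωf : Set (Vec d)) : Set (Vec d) := frontier Ωs ∩ frontier Ωf

/-! ### Function spaces -/

/-- The space `L²(Ω; F)` (Lebesgue measure). -/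
abbrev L2 {d : ℕ} (Ω : Set (Vec d)) (F : Type) [NormedAddCommGroup F] :=
  Lp F 2 ((volume : Measure (Vec d)).restrict Ω)

/-- The space `L²(Γ)ᵈ` for the surface measure (normalized `(d-1)`-dimensional Hausdorff
measure) on a piece `Γ` of a boundary. -/
abbrev L2Surf {d : ℕ} (Γ : Set (Vec d)) :=
  Lp (Vec d) 2 ((Measure.euclideanHausdorffMeasure (d - 1) : Measure (Vec d)).restrict Γ)

/-- The Jacobian `(∂ⱼ φᵢ)ᵢⱼ` of a vector field. -/
def jac {d : ℕ} (φ : Vec d → Vec d) (x : Vec d) : Tensor d :=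
  WithLp.toLp 2 (fun ij => (fderiv ℝ φ x (EuclideanSpace.single ij.2 (1 : ℝ))) ij.1)

/-- `L²(Ω) × L²(Ω) × L²(Γ) × L²(∂Ω ∖ Γ)`. -/
abbrev Ambient {d : ℕ} (Ω Γ : Set (Vec d)) :=
  L2 Ω (Vec d) × L2 Ω (Tensor d) × L2Surf Γ × L2Surf (frontier Ω \ Γ)

/-- The quadruples `(φ|_Ω, ∇φ|_Ω, φ|_Γ, φ|_{∂Ω ∖ Γ})` of smooth vector fields `φ`. -/
def smoothFields {d : ℕ} (Ω Γ : Set (Vec d)) : Submodule ℝ (Ambient Ω Γ) where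
  carrier := {w | ∃ φ : Vec d → Vec d, ContDiff ℝ ∞ φ ∧ HasCompactSupport φ ∧
    w.1 =ᵐ[volume.restrict Ω] φ ∧
    w.2.1 =ᵐ[volume.restrict Ω] jac φ ∧
    w.2.2.1 =ᵐ[(Measure.euclideanHausdorffMeasure (d - 1)).restrict Γ] φ ∧
    w.2.2.2 =ᵐ[(Measure.euclideanHausdorffMeasure (d - 1)).restrict (frontier Ω \ Γ)] φ}
  zero_mem' := by
    refine ⟨0, contDiff_const, HasCompactSupport.zero, Lp.coeFn_zero _ _ _, ?_,
      Lp.coeFn_zero _ _ _, Lp.coeFn_zero _ _ _⟩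
    refine (Lp.coeFn_zero _ _ _).trans (Filter.EventuallyEq.of_eq ?_)
    funext x
    ext ij
    simp [jac]
  add_mem' := by
    rintro v w ⟨φ, hφ, cφ, h1, h2, h3, h4⟩ ⟨ψ, hψ, cψ, k1, k2, k3, k4⟩
    refine ⟨φ + ψ, hφ.add hψ, cφ.add cψ, (Lp.coeFn_add _ _).trans (h1.add k1), ?_,
      (Lp.coeFn_add _ _).trans (h3.add k3), (Lp.coeFn_add _ _).trans (h4.add k4)⟩
    refine (Lp.coeFn_add _ _).trans ((h2.add k2).trans (Filter.EventuallyEq.of_eq ?_))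
    funext x
    ext ij
    have e := fderiv_add (hφ.differentiable (by simp) x) (hψ.differentiable (by simp) x)
    simp [jac, e]
  smul_mem' := by
    rintro c w ⟨φ, hφ, cφ, h1, h2, h3, h4⟩
    refine ⟨c • φ, hφ.const_smul c, cφ.smul_left (f := fun _ => c),
      (Lp.coeFn_smul _ _).trans (h1.const_smul c), ?_,
      (Lp.coeFn_smul _ _).trans (h3.const_smul c), (Lp.coeFn_smul _ _).trans (h4.const_smul c)⟩
    refine (Lp.coeFn_smul _ _).trans ((h2.const_smul c).trans (Filter.EventuallyEq.of_eq ?_))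
    funext x
    ext ij
    have e := fderiv_const_smul (hφ.differentiable (by simp) x) c
    simp [jac, e]

/-- The Sobolev space `H¹(Ω)ᵈ`, as the completion of the smooth fields. An element carries its
value, its weak gradient and its boundary trace, the latter split into the parts on `Γ` and on
`∂Ω ∖ Γ`. (On a bounded Lipschitz domain smooth fields are dense in `H¹`, and the trace is
controlled by the `H¹` norm, so gradient and traces are functions of the value.) -/
def H1 {d : ℕ} (Ω Γ : Set (Vec d)) : Submodule ℝ (Ambient Ω Γ) :=
  (smoothFields Ω Γ).topologicalClosure

/-- The fields in `H¹(Ω)ᵈ` whose trace vanishes on `∂Ω ∖ Γ`. -/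
def H1Zero {d : ℕ} (Ω Γ : Set (Vec d)) : Submodule ℝ (Ambient Ω Γ) where
  carrier := {w | w ∈ H1 Ω Γ ∧ w.2.2.2 = 0}
  zero_mem' := ⟨(H1 Ω Γ).zero_mem, rfl⟩
  add_mem' := fun hv hw => ⟨(H1 Ω Γ).add_mem hv.1 hw.1, by simp [hv.2, hw.2]⟩
  smul_mem' := fun c _ hw => ⟨(H1 Ω Γ).smul_mem c hw.1, by simp [hw.2]⟩

section

variable {d : ℕ} {Ω Γ : Set (Vec d)}

/-- The underlying `L²` field. -/
def val (w : H1Zero Ω Γ) : L2 Ω (Vec d) := w.1.1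

/-- The weak gradient. -/
def grad (w : H1Zero Ω Γ) : L2 Ω (Tensor d) := w.1.2.1

/-- The trace on `Γ`. -/
def trace (w : H1Zero Ω Γ) : L2Surf Γ := w.1.2.2.1

/-- The symmetric gradient `ε(w)`. -/
def eps (w : H1Zero Ω Γ) : L2 Ω (Tensor d) := (symPart d).compLp (grad w)

/-- The divergence. -/
def dvg (w : H1Zero Ω Γ) : L2 Ω ℝ := (tr d).compLp (grad w)

/-- The solid stress `2 L₁ ε(η) + L₂ (div η) I`. -/
def solidStress (L₁ L₂ : ℝ) (η : H1Zero Ω Γ) : L2 Ω (Tensor d) :=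
  (2 * L₁) • eps η + L₂ • (iso d).compLp (dvg η)

/-- The fluid stress `2 μ ε(u) - p I`. -/
def fluidStress (μ : ℝ) (u : H1Zero Ω Γ) (p : L2 Ω ℝ) : L2 Ω (Tensor d) :=
  (2 * μ) • eps u - (iso d).compLp p

/-- The squared elastic norm `2 L₁ ‖ε(w)‖² + L₂ ‖div w‖²`. -/
def elasticNormSq (L₁ L₂ : ℝ) (w : H1Zero Ω Γ) : ℝ :=
  2 * L₁ * ‖eps w‖ ^ 2 + L₂ * ‖dvg w‖ ^ 2

end

/-! ### The two subproblems on one time slab `[a, b]` -/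

/-- Finite-energy weak solution on `[a, b]` of
`ρₛ ∂ₜη' - div σₛ = 0`, `η' = ∂ₜη` in `Ωₛ`, `η = 0` on `∂Ωₛ ∖ Γ`,
`lam η' + σₛ nₛ = lam ũ - σ̃ n` on `Γ`, with initial state `(ηₐ, vₐ)`.

* `η ∈ C([a,b]; H¹)` with zero trace on `∂Ωₛ ∖ Γ`, and `η' ∈ C([a,b]; L²)`;
* `vΓ ∈ L²(a,b; L²(Γ))` is the velocity on `Γ`, i.e. the weak time derivative of the trace of `η`;
* `τ ∈ L²(a,b; L²(Γ))` is the traction `σₛ nₛ`, which is, as the normal trace of a square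
  integrable stress, defined by Green's formula against all `H¹` fields vanishing on `∂Ωₛ ∖ Γ`.

The momentum equation is in its weak form, integrated in time. -/
structure IsSolidSolution {d : ℕ} {Ωs Γ : Set (Vec d)} (ρs L₁ L₂ lam a b : ℝ)
    (uTilde tauTilde : L2Surf Γ) (ηa : H1Zero Ωs Γ) (va : L2 Ωs (Vec d))
    (η : ℝ → H1Zero Ωs Γ) (v : ℝ → L2 Ωs (Vec d)) (vΓ τ : ℝ → L2Surf Γ) : Prop where
  continuous_displacement : ContinuousOn η (Icc a b)
  continuous_velocity : ContinuousOn v (Icc a b)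
  velocity : ∀ t ∈ Icc a b, HasDerivWithinAt (fun s => val (η s)) (v t) (Icc a b) t
  memLp_velocity_trace : MemLp vΓ 2 (volume.restrict (Icc a b))
  velocity_trace : ∀ t ∈ Icc a b, trace (η t) - trace (η a) = ∫ s in a..t, vΓ s
  memLp_traction : MemLp τ 2 (volume.restrict (Icc a b))
  momentum : ∀ w : H1Zero Ωs Γ, ∀ t ∈ Icc a b,
    ρs * inner ℝ (v t - v a) (val w) + ∫ s in a..t, inner ℝ (solidStress L₁ L₂ (η s)) (grad w) =
      ∫ s in a..t, inner ℝ (τ s) (trace w)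
  robin : ∀ᵐ t ∂(volume.restrict (Icc a b)), lam • vΓ t + τ t = lam • uTilde - tauTilde
  initial_displacement : η a = ηa
  initial_velocity : v a = va

/-- Weak solution on `[a, b]` of
`ρ_f ∂ₜu - div σ_f = 0`, `div u = 0` in `Ω_f`, `u = 0` on `∂Ω_f ∖ Γ`,
`lam u + σ_f n = lam η' + σ̃ n` on `Γ`, with initial velocity `uₐ`.

* `u ∈ C([a,b]; L²)`, and `U ∈ L²(a,b; H¹)` is the same field (for almost every time) seen in `H¹`
  with zero trace on `∂Ω_f ∖ Γ`;
* `p ∈ L¹(a,b; L²)` is the pressure;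
* `τ ∈ L²(a,b; L²(Γ))` is the traction `σ_f n`, defined by Green's formula against all
  `H¹` fields vanishing on `∂Ω_f ∖ Γ`.

The momentum equation is in its weak form, integrated in time. -/
structure IsFluidSolution {d : ℕ} {Ωf Γ : Set (Vec d)} (ρf μ lam a b : ℝ)
    (vΓ : ℝ → L2Surf Γ) (tauTilde : L2Surf Γ) (ua : L2 Ωf (Vec d))
    (u : ℝ → L2 Ωf (Vec d)) (U : ℝ → H1Zero Ωf Γ) (p : ℝ → L2 Ωf ℝ)
    (τ : ℝ → L2Surf Γ) : Prop where
  continuous_velocity : ContinuousOn u (Icc a b)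
  memLp_velocity : MemLp U 2 (volume.restrict (Icc a b))
  velocity_eq : ∀ᵐ t ∂(volume.restrict (Icc a b)), val (U t) = u t
  integrable_pressure : IntegrableOn p (Icc a b)
  incompressible : ∀ᵐ t ∂(volume.restrict (Icc a b)), dvg (U t) = 0
  memLp_traction : MemLp τ 2 (volume.restrict (Icc a b))
  momentum : ∀ w : H1Zero Ωf Γ, ∀ t ∈ Icc a b,
    ρf * inner ℝ (u t - u a) (val w) +
        ∫ s in a..t, inner ℝ (fluidStress μ (U s) (p s)) (grad w) =
      ∫ s in a..t, inner ℝ (τ s) (trace w)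
  robin : ∀ᵐ t ∂(volume.restrict (Icc a b)), lam • trace (U t) + τ t = lam • vΓ t + tauTilde
  initial_velocity : u a = ua

/-! ### The splitting scheme -/

/-- The physical and numerical parameters. -/
structure Params where
  ρs : ℝ
  ρf : ℝ
  L₁ : ℝ
  L₂ : ℝ
  μ : ℝ
  lam : ℝ
  dt : ℝ
  ρs_pos : 0 < ρs
  ρf_pos : 0 < ρf
  L₁_pos : 0 < L₁
  L₂_nonneg : 0 ≤ L₂
  μ_pos : 0 < μ
  lam_pos : 0 < lam
  dt_pos : 0 < dt

/-- The grid point `tₙ = n Δt`. -/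
def Params.t (P : Params) (n : ℕ) : ℝ := n * P.dt

/-- The iterates. For `n ≥ 1` the functions with index `n` live on the slab `[tₙ₋₁, tₙ]`; those
with index `0` are used only at the time `t₀ = 0`, where they are the initial data. -/
structure Iterates {d : ℕ} (Ωs Ωf : Set (Vec d)) where
  /-- solid displacement -/
  η : ℕ → ℝ → H1Zero Ωs (interface Ωs Ωf)
  /-- solid velocity -/
  v : ℕ → ℝ → L2 Ωs (Vec d)
  /-- solid velocity on the interface -/
  vΓ : ℕ → ℝ → L2Surf (interface Ωs Ωf)
  /-- solid traction `σₛ nₛ` on the interface -/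
  τs : ℕ → ℝ → L2Surf (interface Ωs Ωf)
  /-- fluid velocity, as a field in `L²` -/
  u : ℕ → ℝ → L2 Ωf (Vec d)
  /-- fluid velocity, as a field in `H¹` -/
  U : ℕ → ℝ → H1Zero Ωf (interface Ωs Ωf)
  /-- fluid pressure -/
  p : ℕ → ℝ → L2 Ωf ℝ
  /-- fluid traction `σ_f n` on the interface -/
  τf : ℕ → ℝ → L2Surf (interface Ωs Ωf)

namespace Iterates

variable {d : ℕ} {Ωs Ωf : Set (Vec d)} (I : Iterates Ωs Ωf) (P : Params)

/-- `ũⁿ` on the interface: the time average of `uⁿ` over the slab `[tₙ₋₁, tₙ]`, and the initial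
value for `n = 0`. -/
def uTilde : ℕ → L2Surf (interface Ωs Ωf)
  | 0 => trace (I.U 0 (P.t 0))
  | n + 1 => (1 / P.dt) • ∫ s in P.t n..P.t (n + 1), trace (I.U (n + 1) s)

/-- `σ̃_fⁿ n` on the interface: the time average of `σ_fⁿ n` over the slab `[tₙ₋₁, tₙ]`, and the
initial value for `n = 0`. -/
def tauTilde : ℕ → L2Surf (interface Ωs Ωf)
  | 0 => I.τf 0 (P.t 0)
  | n + 1 => (1 / P.dt) • ∫ s in P.t n..P.t (n + 1), I.τf (n + 1) s

/-- The iterates solve the solid and then the fluid subproblem on `[tₙ, tₙ₊₁]` for all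
`0 ≤ n ≤ N - 1`. -/
structure IsSolution (N : ℕ) : Prop where
  initial : val (I.U 0 (P.t 0)) = I.u 0 (P.t 0)
  solid : ∀ n < N, IsSolidSolution P.ρs P.L₁ P.L₂ P.lam (P.t n) (P.t (n + 1))
    (I.uTilde P n) (I.tauTilde P n) (I.η n (P.t n)) (I.v n (P.t n))
    (I.η (n + 1)) (I.v (n + 1)) (I.vΓ (n + 1)) (I.τs (n + 1))
  fluid : ∀ n < N, IsFluidSolution P.ρf P.μ P.lam (P.t n) (P.t (n + 1))
    (I.vΓ (n + 1)) (I.tauTilde P n) (I.u n (P.t n))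
    (I.u (n + 1)) (I.U (n + 1)) (I.p (n + 1)) (I.τf (n + 1))

/-- The energy `Eⁿ`. -/
def energy (n : ℕ) : ℝ :=
  P.ρf / 2 * ‖I.u n (P.t n)‖ ^ 2 + P.ρs / 2 * ‖I.v n (P.t n)‖ ^ 2 +
    1 / 2 * elasticNormSq P.L₁ P.L₂ (I.η n (P.t n))

/-- The dissipation `Tⁿ⁺¹`, on the slab `[tₙ, tₙ₊₁]`. -/
def dissipationSucc (n : ℕ) : ℝ :=
  2 * P.μ * (∫ s in P.t n..P.t (n + 1), ‖eps (I.U (n + 1) s)‖ ^ 2) +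
    P.lam / 2 * ∫ s in P.t n..P.t (n + 1), ‖I.vΓ (n + 1) s - I.uTilde P n‖ ^ 2

/-- The interface terms `Sⁿ`. -/
def interfaceTerm : ℕ → ℝ
  | 0 => P.dt / (2 * P.lam) * ‖I.τf 0 (P.t 0)‖ ^ 2 +
      P.lam * P.dt / 2 * ‖trace (I.U 0 (P.t 0))‖ ^ 2
  | n + 1 => 1 / (2 * P.lam) * (∫ s in P.t n..P.t (n + 1), ‖I.τf (n + 1) s‖ ^ 2) +
      P.lam / 2 * ∫ s in P.t n..P.t (n + 1), ‖trace (I.U (n + 1) s)‖ ^ 2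

end Iterates

end

end RobinFSI

namespace RobinFSI

noncomputable section

open Filter Topology

/-! ### Steklov averages on the real line -/

section Averages

variable {X : Type*} [NormedAddCommGroup X]

/-! On one slab, testing the fluid equation formally with its velocity and the solid equation with
its own velocity gives an energy balance driven by the interface powers `∫ τf · u` and `∫ τs · vΓ`.
By the two Robin conditions (`robin_identity`) these powers, together with the interface dissipation
and the new interface terms, add up exactly to the same quadratic interface expression in the
averaged data of the previous slab. Jensen (`mul_norm_average_sq_le`) bounds that expression by the
previous interface term. This is the only inequality, and summing over the slabs telescopes.

The formal tests are not admissible: the weak equations hold only against fields fixed in time, the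
velocities have no time derivative, and the solid velocity is merely `L²` in space. Instead, the
momentum equation at `t` is subtracted from the one at `t + h`, tested with `∫ U` over `[t, t + h]`
for the fluid and with `η (t + h) - η t` for the solid, integrated over `t ∈ [a, b - h]` and divided
by `h²`. As `h → 0`, products of two window integrals converge by
`tendsto_integral_inner_windowIntegral`. An increment paired with the window integral of the same
function is an exact derivative, and it converges by `tendsto_integral_inner_sub_windowIntegral`.
This proves `energy_identity_parabolic` and `energy_identity_hyperbolic` without extra regularity.
-/

theorem tendsto_eLpNorm_translate_sub {f : ℝ → X} (hf : MemLp f 2 volume) :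
    Tendsto (fun r : ℝ => eLpNorm (fun t => f (t + r) - f t) 2 volume) (𝓝 0) (𝓝 0) := by
  have h2 : Fact ((2 : ENNReal) ≠ ⊤) := ⟨by simp⟩
  -- The translation group acts continuously on `L²`, so the orbit of `f` is continuous at `r = 0`.
  have hc : Continuous fun r : ℝ => (DomAddAct.mk r) +ᵥ hf.toLp f := by fun_prop
  have ht := (hc.tendsto 0).edist (tendsto_const_nhds (x := hf.toLp f))
  have h0 : edist (DomAddAct.mk (0 : ℝ) +ᵥ hf.toLp f) (hf.toLp f) = 0 := by simp
  rw [h0] at ht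
  refine ht.congr fun r => ?_
  rw [DomAddAct.mk_vadd_toLp, Lp.edist_toLp_toLp]
  congr 1
  funext t
  simp [add_comm]

variable [NormedSpace ℝ X]

theorem enorm_integral_sq_le {α : Type*} [MeasurableSpace α] (μ : Measure α) {f : α → X}
    (hf : AEStronglyMeasurable f μ) :
    ‖∫ x, f x ∂μ‖ₑ ^ 2 ≤ μ univ * ∫⁻ x, ‖f x‖ₑ ^ 2 ∂μ := by
  have h1 : ‖∫ x, f x ∂μ‖ₑ ≤ ∫⁻ x, ‖f x‖ₑ * 1 ∂μ := by
    simpa using enorm_integral_le_lintegral_enorm f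
  have h2 := ENNReal.lintegral_mul_le_Lp_mul_Lq μ Real.HolderConjugate.two_two hf.enorm
    (aemeasurable_const (b := (1 : ENNReal)))
  have h3 := pow_le_pow_left' (h1.trans h2) 2
  refine h3.trans (le_of_eq ?_)
  rw [mul_pow, ← ENNReal.rpow_natCast, ← ENNReal.rpow_natCast, ← ENNReal.rpow_mul,
    ← ENNReal.rpow_mul]
  simp [mul_comm]

/-- The integral of `f` over the window `[t, t + h]`. -/
def windowIntegral (f : ℝ → X) (h t : ℝ) : X := ∫ s in t..t + h, f s

omit [NormedSpace ℝ X] in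
theorem intervalIntegrable_of_memLp_two {f : ℝ → X} (hf : MemLp f 2 volume) (a b : ℝ) :
    IntervalIntegrable f volume a b := by
  have h : LocallyIntegrable f volume := hf.locallyIntegrable (by norm_num)
  exact (h.integrableOn_isCompact isCompact_uIcc).intervalIntegrable

variable [CompleteSpace X]

omit [CompleteSpace X] in
theorem continuous_windowIntegral {f : ℝ → X} (hf : ∀ a b, IntervalIntegrable f volume a b)
    (h : ℝ) : Continuous (windowIntegral f h) := by
  have h1 : Continuous fun t => ∫ s in (0 : ℝ)..t, f s :=
    intervalIntegral.continuous_primitive hf 0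
  have : windowIntegral f h = fun t => (∫ s in (0 : ℝ)..t + h, f s) - ∫ s in (0 : ℝ)..t, f s := by
    funext t
    rw [intervalIntegral.integral_interval_sub_left (hf _ _) (hf _ _)]
    rfl
  rw [this]
  fun_prop

/-- The error at `t` is the mean over `r ∈ (0, h]` of `f (t + r) - f t`; Cauchy–Schwarz costs one
factor `h` against `h⁻²`. -/
theorem enorm_windowIntegral_sub_sq_le {f : ℝ → X} (hf : ∀ a b, IntervalIntegrable f volume a b)
    {h : ℝ} (hh : 0 < h) (t : ℝ) :
    ‖h⁻¹ • windowIntegral f h t - f t‖ₑ ^ 2 ≤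
      (ENNReal.ofReal h)⁻¹ * ∫⁻ r in Ioc 0 h, ‖f (t + r) - f t‖ₑ ^ 2 := by
  have hi : IntervalIntegrable (fun r => f (t + r)) volume 0 h := by
    simpa using (hf t (t + h)).comp_add_left t
  have e : h⁻¹ • windowIntegral f h t - f t = h⁻¹ • ∫ r in Ioc 0 h, (f (t + r) - f t) := by
    rw [← intervalIntegral.integral_of_le hh.le, intervalIntegral.integral_sub hi (by simp),
      intervalIntegral.integral_comp_add_left (fun s => f s), smul_sub]
    simp [windowIntegral, smul_smul, hh.ne']
  have hm : AEStronglyMeasurable (fun r => f (t + r) - f t) (volume.restrict (Ioc 0 h)) := by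
    have := (hi.1.sub (integrable_const (f t))).aestronglyMeasurable
    exact this
  rw [e, enorm_smul, mul_pow]
  have hn : ‖h⁻¹‖ₑ = (ENNReal.ofReal h)⁻¹ := by
    rw [Real.enorm_of_nonneg (by positivity), ENNReal.ofReal_inv_of_pos hh]
  have hne : ENNReal.ofReal h ≠ 0 := by simpa using hh
  calc _ ≤ ‖h⁻¹‖ₑ ^ 2 * (ENNReal.ofReal h * ∫⁻ r in Ioc 0 h, ‖f (t + r) - f t‖ₑ ^ 2) := by
        gcongr
        simpa using enorm_integral_sq_le _ hm
    _ = _ := by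
        rw [hn, ← mul_assoc, sq, mul_assoc (ENNReal.ofReal h)⁻¹,
          ENNReal.inv_mul_cancel hne ENNReal.ofReal_ne_top, mul_one]

omit [NormedSpace ℝ X] [CompleteSpace X] in
theorem eLpNorm_two_sq {α : Type*} [MeasurableSpace α] (μ : Measure α) (f : α → X) :
    eLpNorm f 2 μ ^ 2 = ∫⁻ x, ‖f x‖ₑ ^ 2 ∂μ := by
  have := eLpNorm_nnreal_pow_eq_lintegral (μ := μ) (f := f) (p := 2) (by simp)
  simpa using this

/-- Steklov averages converge in `L²`. -/
theorem tendsto_eLpNorm_average_sub {f : ℝ → X} (hf : MemLp f 2 volume) :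
    Tendsto (fun h : ℝ => eLpNorm (fun t => h⁻¹ • windowIntegral f h t - f t) 2 volume)
      (𝓝[>] 0) (𝓝 0) := by
  rw [ENNReal.tendsto_nhds_zero]
  intro ε hε
  have h1 := ENNReal.tendsto_nhds_zero.1 (tendsto_eLpNorm_translate_sub hf) ε hε
  obtain ⟨δ, hδ, hball⟩ := Metric.eventually_nhds_iff.1 h1
  filter_upwards [Ioo_mem_nhdsGT hδ] with h hh
  have hint := intervalIntegrable_of_memLp_two hf
  have hpair : AEMeasurable (Function.uncurry fun t r => ‖f (t + r) - f t‖ₑ ^ 2)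
      (volume.prod (volume.restrict (Ioc 0 h))) := by
    have q : Measure.QuasiMeasurePreserving (fun p : ℝ × ℝ => p.1 + p.2)
        (volume.prod (volume.restrict (Ioc 0 h))) volume := by
      have q0 : Measure.QuasiMeasurePreserving (fun p : ℝ × ℝ => p.1 + p.2)
        (volume.prod volume) volume := quasiMeasurePreserving_add _ _
      refine q0.mono_left ?_
      exact Measure.AbsolutelyContinuous.prod Measure.AbsolutelyContinuous.rfl
        Measure.restrict_le_self.absolutelyContinuous
    have m1 := hf.1.comp_quasiMeasurePreserving q
    have m2 := hf.1.comp_quasiMeasurePreserving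
      (Measure.quasiMeasurePreserving_fst (μ := volume) (ν := volume.restrict (Ioc 0 h)))
    exact (m1.sub m2).enorm.pow_const 2
  have hne : ENNReal.ofReal h ≠ 0 := by simpa using hh.1
  -- After Tonelli the inner integral is the squared `L²` distance between `f` and its translate by
  -- `r ≤ h < δ`.
  have key : eLpNorm (fun t => h⁻¹ • windowIntegral f h t - f t) 2 volume ^ 2 ≤ ε ^ 2 := by
    rw [eLpNorm_two_sq]
    calc _ ≤ ∫⁻ t, (ENNReal.ofReal h)⁻¹ * ∫⁻ r in Ioc 0 h, ‖f (t + r) - f t‖ₑ ^ 2 :=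
          lintegral_mono fun t => enorm_windowIntegral_sub_sq_le hint hh.1 t
      _ = (ENNReal.ofReal h)⁻¹ * ∫⁻ r in Ioc 0 h, ∫⁻ t, ‖f (t + r) - f t‖ₑ ^ 2 := by
          rw [lintegral_const_mul' _ _ (by simpa using hh.1), lintegral_lintegral_swap hpair]
      _ ≤ (ENNReal.ofReal h)⁻¹ * ∫⁻ r in Ioc 0 h, ε ^ 2 := by
          gcongr (ENNReal.ofReal h)⁻¹ * ?_
          refine setLIntegral_mono measurable_const fun r hr => ?_
          rw [← eLpNorm_two_sq]
          gcongr
          refine hball ?_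
          simp only [dist_zero_right, Real.norm_eq_abs, abs_of_pos hr.1]
          exact hr.2.trans_lt hh.2
      _ = ε ^ 2 := by
          simp only [lintegral_const, Measure.restrict_apply_univ, Real.volume_Ioc, sub_zero]
          rw [mul_comm, mul_assoc, ENNReal.mul_inv_cancel hne ENNReal.ofReal_ne_top, mul_one]
  exact (ENNReal.pow_le_pow_left_iff two_ne_zero).1 key

end Averages

/-! ### Window integrals inside a bounded interval -/

section Window

variable {X : Type*} [NormedAddCommGroup X] [NormedSpace ℝ X]

theorem windowIntegral_congr {f g : ℝ → X} {a b h t : ℝ} (hfg : EqOn f g (Icc a b)) (hh : 0 ≤ h)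
    (ht : t ∈ Icc a (b - h)) : windowIntegral f h t = windowIntegral g h t := by
  refine intervalIntegral.integral_congr fun s hs => hfg ?_
  rw [uIcc_of_le (by linarith)] at hs
  exact ⟨ht.1.trans hs.1, hs.2.trans (by linarith [ht.2])⟩

theorem continuousOn_windowIntegral {f : ℝ → X} {a b h : ℝ} (hf : IntegrableOn f (Icc a b))
    (hh : 0 ≤ h) : ContinuousOn (windowIntegral f h) (Icc a (b - h)) := by
  have h1 : Integrable ((Icc a b).indicator f) := hf.integrable_indicator measurableSet_Icc
  have h2 := continuous_windowIntegral (fun x y => h1.intervalIntegrable (a := x) (b := y)) h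
  refine h2.continuousOn.congr fun t ht => ?_
  exact windowIntegral_congr (fun s hs => by simp [hs]) hh ht

end Window

/-! ### Limits of time-averaged pairings -/

section Limits

variable {X : Type*} [NormedAddCommGroup X] [InnerProductSpace ℝ X]

theorem tendsto_integral_inner {α ι : Type*} [MeasurableSpace α] {μ : Measure α} {l : Filter ι}
    {f g : ι → α → X} {f₀ g₀ : α → X} (hf : ∀ i, AEStronglyMeasurable (f i) μ)
    (hg : ∀ i, AEStronglyMeasurable (g i) μ) (hf₀ : MemLp f₀ 2 μ) (hg₀ : MemLp g₀ 2 μ)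
    (hfl : Tendsto (fun i => eLpNorm (fun x => f i x - f₀ x) 2 μ) l (𝓝 0))
    (hgl : Tendsto (fun i => eLpNorm (fun x => g i x - g₀ x) 2 μ) l (𝓝 0)) :
    Tendsto (fun i => ∫ x, inner ℝ (f i x) (g i x) ∂μ) l (𝓝 (∫ x, inner ℝ (f₀ x) (g₀ x) ∂μ)) := by
  classical
  have mem : ∀ {f : ι → α → X} {f₀ : α → X}, (∀ i, AEStronglyMeasurable (f i) μ) →
      MemLp f₀ 2 μ → Tendsto (fun i => eLpNorm (fun x => f i x - f₀ x) 2 μ) l (𝓝 0) →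
      ∀ᶠ i in l, MemLp (f i) 2 μ := by
    intro f f₀ hf hf₀ hfl
    filter_upwards [hfl.eventually (gt_mem_nhds ENNReal.zero_lt_top)] with i hi
    have : MemLp (fun x => f i x - f₀ x) 2 μ := ⟨(hf i).sub hf₀.1, hi⟩
    exact (this.add hf₀).ae_eq (Eventually.of_forall fun x => by simp)
  -- The default `0` is harmless: convergence to an `L²` function puts `f i` in `L²` eventually.
  let T : (α → X) → Lp X 2 μ := fun f => if h : MemLp f 2 μ then h.toLp f else 0
  have hT : ∀ {f : α → X}, MemLp f 2 μ → T f =ᵐ[μ] f := by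
    intro f h
    simp only [T, h, dif_pos]
    exact h.coeFn_toLp
  have lim : ∀ {f : ι → α → X} {f₀ : α → X}, (∀ i, AEStronglyMeasurable (f i) μ) →
      MemLp f₀ 2 μ → Tendsto (fun i => eLpNorm (fun x => f i x - f₀ x) 2 μ) l (𝓝 0) →
      Tendsto (fun i => T (f i)) l (𝓝 (T f₀)) := by
    intro f f₀ hf hf₀ hfl
    rw [tendsto_iff_edist_tendsto_0]
    refine hfl.congr' ?_
    filter_upwards [mem hf hf₀ hfl] with i hi
    simp only [T, hi, hf₀, dif_pos]
    rw [Lp.edist_toLp_toLp]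
    rfl
  have inn : ∀ {f g : α → X}, MemLp f 2 μ → MemLp g 2 μ →
      inner ℝ (T f) (T g) = ∫ x, inner ℝ (f x) (g x) ∂μ := by
    intro f g hf hg
    rw [L2.inner_def]
    refine integral_congr_ae ?_
    filter_upwards [hT hf, hT hg] with x h1 h2
    rw [h1, h2]
  rw [← inn hf₀ hg₀]
  refine ((lim hf hf₀ hfl).inner (lim hg hg₀ hgl)).congr' ?_
  filter_upwards [mem hf hf₀ hfl, mem hg hg₀ hgl] with i h1 h2
  exact inn h1 h2

omit [InnerProductSpace ℝ X] in
-- Absolute continuity of the integral of `‖g‖²`. It controls the strip at the right end where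
-- windows would leave `[a, b]`.
theorem tendsto_eLpNorm_indicator_Ioc {g : ℝ → X} (hg : MemLp g 2 volume) (b : ℝ) :
    Tendsto (fun h : ℝ => eLpNorm ((Ioc (b - h) b).indicator g) 2 volume) (𝓝[>] 0) (𝓝 0) := by
  rw [ENNReal.tendsto_nhds_zero]
  intro ε hε
  rcases eq_or_ne ε ⊤ with rfl | hε'
  · simp
  obtain ⟨δ, hδ, H⟩ := hg.eLpNorm_indicator_le (by norm_num) (by norm_num)
    (ENNReal.toReal_pos hε.ne' hε')
  filter_upwards [Ioo_mem_nhdsGT hδ] with h hh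
  have := H (Ioc (b - h) b) measurableSet_Ioc (by simpa using ENNReal.ofReal_le_ofReal hh.2.le)
  rwa [ENNReal.ofReal_toReal hε'] at this

/-- The averages over windows inside `[a, b]` of two square integrable functions converge to the
functions in the sense of the `L²` inner product. -/
theorem tendsto_integral_inner_windowIntegral {F G : ℝ → X} {a b : ℝ} (hab : a < b)
    [CompleteSpace X]
    (hF : MemLp F 2 (volume.restrict (Icc a b))) (hG : MemLp G 2 (volume.restrict (Icc a b))) :
    Tendsto (fun h : ℝ => h⁻¹ ^ 2 *
        ∫ t in a..b - h, inner ℝ (windowIntegral F h t) (windowIntegral G h t))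
      (𝓝[>] 0) (𝓝 (∫ t in a..b, inner ℝ (F t) (G t))) := by
  set F' := (Icc a b).indicator F with hF'
  set G' := (Icc a b).indicator G with hG'
  have mF : MemLp F' 2 volume := (memLp_indicator_iff_restrict measurableSet_Icc).2 hF
  have mG : MemLp G' 2 volume := (memLp_indicator_iff_restrict measurableSet_Icc).2 hG
  have cF := fun h => continuous_windowIntegral (intervalIntegrable_of_memLp_two mF) h
  have cG := fun h => continuous_windowIntegral (intervalIntegrable_of_memLp_two mG) h
  have sF : ∀ h : ℝ, AEStronglyMeasurable (fun t => h⁻¹ • windowIntegral F' h t) volume :=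
    fun h => ((cF h).const_smul _).aestronglyMeasurable
  have sG : ∀ h : ℝ, AEStronglyMeasurable (fun t => h⁻¹ • windowIntegral G' h t) volume :=
    fun h => ((cG h).const_smul _).aestronglyMeasurable
  have small : ∀ᶠ h : ℝ in 𝓝[>] 0, 0 < h ∧ h < b - a := by
    filter_upwards [Ioo_mem_nhdsGT (sub_pos.2 hab)] with h hh using hh
  -- Cutting off one factor to `[a, b - h]` already localizes the product, so the averages of `F'`
  -- stay uncut. The error splits into the averaging error on `[a, b - h]` and `G'` on the strip `(b
  -- - h, b]`.
  have lG : Tendsto (fun h : ℝ => eLpNorm (fun t =>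
      (Icc a (b - h)).indicator (fun t => h⁻¹ • windowIntegral G' h t) t - G' t) 2 volume)
      (𝓝[>] 0) (𝓝 0) := by
    have l0 := (tendsto_eLpNorm_average_sub mG).add (tendsto_eLpNorm_indicator_Ioc mG b)
    rw [add_zero] at l0
    refine tendsto_of_tendsto_of_tendsto_of_le_of_le' tendsto_const_nhds l0
      (Eventually.of_forall fun _ => zero_le) ?_
    filter_upwards [small] with h hh
    have e : (fun t => (Icc a (b - h)).indicator (fun t => h⁻¹ • windowIntegral G' h t) t - G' t) =
        (Icc a (b - h)).indicator (fun t => h⁻¹ • windowIntegral G' h t - G' t) -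
          (Ioc (b - h) b).indicator G' := by
      funext t
      simp only [Pi.sub_apply, indicator_apply, hG', mem_Icc, mem_Ioc]
      by_cases h1 : a ≤ t <;> by_cases h2 : t ≤ b - h <;> by_cases h3 : t ≤ b <;>
        simp [h1, h2, h3, not_le.1, not_lt.2]
    rw [e]
    refine (eLpNorm_sub_le (((sG h).sub mG.1).indicator measurableSet_Icc)
      (mG.1.indicator measurableSet_Ioc) (by norm_num)).trans ?_
    gcongr
    exact eLpNorm_indicator_le _
  have main := tendsto_integral_inner (μ := volume) (l := 𝓝[>] (0 : ℝ)) sF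
    (fun h => (sG h).indicator (measurableSet_Icc (a := a) (b := b - h))) mF mG
    (tendsto_eLpNorm_average_sub mF) lG
  have e0 : ∫ t, inner ℝ (F' t) (G' t) = ∫ t in a..b, inner ℝ (F t) (G t) := by
    rw [intervalIntegral.integral_of_le hab.le, ← integral_Icc_eq_integral_Ioc,
      ← integral_indicator measurableSet_Icc]
    congr 1
    funext t
    by_cases ht : t ∈ Icc a b <;> simp [hF', hG', ht]
  rw [e0] at main
  refine main.congr' ?_
  filter_upwards [small] with h hh
  rw [intervalIntegral.integral_of_le (by linarith), ← integral_Icc_eq_integral_Ioc,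
    ← integral_const_mul, ← integral_indicator measurableSet_Icc]
  congr 1
  funext t
  by_cases ht : t ∈ Icc a (b - h)
  · have eF : windowIntegral F' h t = windowIntegral F h t :=
      windowIntegral_congr (fun s hs => by simp [hF', hs]) hh.1.le ht
    have eG : windowIntegral G' h t = windowIntegral G h t :=
      windowIntegral_congr (fun s hs => by simp [hG', hs]) hh.1.le ht
    simp only [indicator_of_mem ht, inner_smul_left, inner_smul_right, eF, eG]
    simp
    ring
  · simp [indicator_of_notMem ht]

theorem tendsto_inv_smul_integral_nhdsGT [CompleteSpace X] {f : ℝ → X} (hf : Continuous f)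
    (a : ℝ) : Tendsto (fun h : ℝ => h⁻¹ • ∫ s in a..a + h, f s) (𝓝[>] 0) (𝓝 (f a)) := by
  have h1 := (hf.integral_hasStrictDerivAt a a).hasDerivAt.tendsto_slope_zero_right
  simpa using h1

/-- The telescoping identity behind the energy balance: for a continuous `f`, testing increments
of `f` with window integrals of `f` yields the increment of `‖f‖² / 2`. -/
theorem tendsto_integral_inner_sub_windowIntegral [CompleteSpace X] {f : ℝ → X} {a b : ℝ}
    (hab : a < b) (hf : ContinuousOn f (Icc a b)) :
    Tendsto (fun h : ℝ => h⁻¹ ^ 2 * ∫ t in a..b - h, inner ℝ (f (t + h) - f t)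
        (windowIntegral f h t))
      (𝓝[>] 0) (𝓝 (1 / 2 * ‖f b‖ ^ 2 - 1 / 2 * ‖f a‖ ^ 2)) := by
  -- Constant extension past the endpoints keeps continuity, so window integrals become
  -- differentiable on all of `ℝ`.
  set g : ℝ → X := IccExtend hab.le ((Icc a b).domRestrict f) with hg
  have gc : Continuous g := hf.domRestrict.Icc_extend'
  have gf : EqOn f g (Icc a b) := fun t ht => by rw [hg, IccExtend_of_mem hab.le _ ht]; rfl
  have ii : ∀ x y, IntervalIntegrable g volume x y := fun x y => gc.intervalIntegrable x y
  have hd : ∀ h t, HasDerivAt (windowIntegral g h) (g (t + h) - g t) t := by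
    intro h t
    have e : windowIntegral g h = fun t => (∫ s in (0 : ℝ)..t + h, g s) - ∫ s in (0 : ℝ)..t, g s := by
      funext t
      rw [intervalIntegral.integral_interval_sub_left (ii _ _) (ii _ _)]
      rfl
    rw [e]
    exact ((gc.integral_hasStrictDerivAt 0 (t + h)).hasDerivAt.comp_add_const t h).sub
      (gc.integral_hasStrictDerivAt 0 t).hasDerivAt
  have cw : ∀ h, Continuous (windowIntegral g h) := fun h => continuous_windowIntegral ii h
  -- The increment `g (t + h) - g t` is the derivative of the window integral, so only the two end
  -- windows survive.
  have ftc : ∀ h, ∫ t in a..b - h, inner ℝ (g (t + h) - g t) (windowIntegral g h t) =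
      1 / 2 * ‖windowIntegral g h (b - h)‖ ^ 2 - 1 / 2 * ‖windowIntegral g h a‖ ^ 2 := by
    intro h
    refine intervalIntegral.integral_eq_sub_of_hasDerivAt
      (f := fun t => 1 / 2 * ‖windowIntegral g h t‖ ^ 2) (fun t _ => ?_) ?_
    · refine ((hd h t).norm_sq.const_mul (1 / 2 : ℝ)).congr_deriv ?_
      rw [real_inner_comm]
      ring
    · have := cw h
      exact Continuous.intervalIntegrable (by fun_prop) _ _
  have la : Tendsto (fun h : ℝ => h⁻¹ • windowIntegral g h a) (𝓝[>] 0) (𝓝 (g a)) :=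
    tendsto_inv_smul_integral_nhdsGT gc a
  -- The last window `[b - h, b]` lies to the left of `b`; the reflection `s ↦ 2b - s` moves it to
  -- the right.
  have lb : Tendsto (fun h : ℝ => h⁻¹ • windowIntegral g h (b - h)) (𝓝[>] 0) (𝓝 (g b)) := by
    have := tendsto_inv_smul_integral_nhdsGT (f := fun s => g (2 * b - s)) (by fun_prop) b
    have e : 2 * b - b = b := by ring
    rw [e] at this
    refine this.congr fun h => ?_
    rw [intervalIntegral.integral_comp_sub_left (fun s => g s)]
    simp only [windowIntegral]
    congr 2 <;> ring
  have l := ((lb.norm.pow 2).const_mul (1 / 2)).sub ((la.norm.pow 2).const_mul (1 / 2))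
  rw [gf ⟨hab.le, le_rfl⟩, gf ⟨le_rfl, hab.le⟩]
  refine l.congr' ?_
  filter_upwards [Ioo_mem_nhdsGT (sub_pos.2 hab)] with h hh
  have e : ∫ t in a..b - h, inner ℝ (f (t + h) - f t) (windowIntegral f h t) =
      ∫ t in a..b - h, inner ℝ (g (t + h) - g t) (windowIntegral g h t) := by
    refine intervalIntegral.integral_congr fun t ht => ?_
    rw [uIcc_of_le (by linarith [hh.2])] at ht
    rw [windowIntegral_congr gf hh.1.le ht, gf ⟨by linarith [ht.1, hh.1], by linarith [ht.2]⟩,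
      gf ⟨ht.1, by linarith [ht.2, hh.1]⟩]
  rw [e, ftc]
  simp only [norm_smul, mul_pow, norm_inv, inv_pow, Real.norm_eq_abs, sq_abs]
  ring

end Limits

/-! ### Stress pairings and completeness of the test space -/

section Fields

variable {d : ℕ} {Ω Γ : Set (Vec d)}

/-- A symmetric tensor pairs equally with `H` and with its transpose. -/
theorem inner_symPart (G H : Tensor d) :
    inner ℝ (symPart d G) (symPart d H) = inner ℝ (symPart d G) H := by
  have swap : ∑ ij : Fin d × Fin d, (symPart d G) ij * H (ij.2, ij.1) =
      ∑ ij : Fin d × Fin d, (symPart d G) ij * H ij := by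
    rw [← (Equiv.prodComm (Fin d) (Fin d)).sum_comp]
    refine Finset.sum_congr rfl fun ij _ => ?_
    obtain ⟨i, j⟩ := ij
    simp [symPart, add_comm]
  have e : ∀ G H : Tensor d, inner ℝ G H = ∑ ij, G ij * H ij := fun G H => by
    simp [PiLp.inner_apply, mul_comm]
  have e2 : ∀ ij, (symPart d H) ij = (H ij + H (ij.2, ij.1)) / 2 := fun ij => rfl
  rw [e, e]
  have : ∑ ij : Fin d × Fin d, (symPart d G) ij * (symPart d H) ij =
      (∑ ij, (symPart d G) ij * H ij + ∑ ij, (symPart d G) ij * H (ij.2, ij.1)) / 2 := by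
    rw [← Finset.sum_add_distrib, Finset.sum_div]
    refine Finset.sum_congr rfl fun ij _ => ?_
    rw [e2]
    ring
  rw [this, swap]
  ring

theorem inner_iso (q : ℝ) (G : Tensor d) : inner ℝ (iso d q) G = inner ℝ q (tr d G) := by
  simp [PiLp.inner_apply, iso, tr, Fintype.sum_prod_type, mul_comm, Finset.mul_sum]

/-- The value as a continuous linear map. -/
def valL : H1Zero Ω Γ →L[ℝ] L2 Ω (Vec d) :=
  (ContinuousLinearMap.fst ℝ _ _).comp (H1Zero Ω Γ).subtypeL

/-- The weak gradient as a continuous linear map. -/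
def gradL : H1Zero Ω Γ →L[ℝ] L2 Ω (Tensor d) :=
  ((ContinuousLinearMap.fst ℝ _ _).comp (ContinuousLinearMap.snd ℝ _ _)).comp
    (H1Zero Ω Γ).subtypeL

/-- The trace as a continuous linear map. -/
def traceL : H1Zero Ω Γ →L[ℝ] L2Surf Γ :=
  ((ContinuousLinearMap.fst ℝ _ _).comp ((ContinuousLinearMap.snd ℝ _ _).comp
    (ContinuousLinearMap.snd ℝ _ _))).comp (H1Zero Ω Γ).subtypeL

/-- The symmetric gradient as a continuous linear map. -/
def epsL : H1Zero Ω Γ →L[ℝ] L2 Ω (Tensor d) := ((symPart d).compLpL 2 _).comp gradL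

/-- The divergence as a continuous linear map. -/
def dvgL : H1Zero Ω Γ →L[ℝ] L2 Ω ℝ := ((tr d).compLpL 2 _).comp gradL

theorem traceL_apply (w : H1Zero Ω Γ) : traceL w = trace w := rfl
theorem epsL_apply (w : H1Zero Ω Γ) : epsL w = eps w := rfl
theorem dvgL_apply (w : H1Zero Ω Γ) : dvgL w = dvg w := rfl

theorem inner_eps_grad (η w : H1Zero Ω Γ) :
    inner ℝ (eps η) (grad w) = inner ℝ (epsL η) (epsL w) := by
  rw [L2.inner_def, L2.inner_def]
  refine integral_congr_ae ?_
  filter_upwards [(symPart d).coeFn_compLp (grad η), (symPart d).coeFn_compLp (grad w)] with x h1 h2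
  change _ = inner ℝ (eps η x) (eps w x)
  rw [eps, eps, h1, h2, inner_symPart]

theorem inner_iso_grad (q : L2 Ω ℝ) (w : H1Zero Ω Γ) :
    inner ℝ ((iso d).compLp q) (grad w) = inner ℝ q (dvgL w) := by
  rw [L2.inner_def, L2.inner_def]
  refine integral_congr_ae ?_
  filter_upwards [(iso d).coeFn_compLp q, (tr d).coeFn_compLp (grad w)] with x h1 h2
  change _ = inner ℝ (q x) (dvg w x)
  rw [dvg, h1, h2, inner_iso]

theorem inner_smul_add_smul_left {X : Type*} [NormedAddCommGroup X] [InnerProductSpace ℝ X]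
    (r s : ℝ) (x y z : X) : inner ℝ (r • x + s • y) z = r * inner ℝ x z + s * inner ℝ y z := by
  rw [inner_add_left, real_inner_smul_left, real_inner_smul_left]

theorem inner_smul_sub_left {X : Type*} [NormedAddCommGroup X] [InnerProductSpace ℝ X]
    (r : ℝ) (x y z : X) : inner ℝ (r • x - y) z = r * inner ℝ x z - inner ℝ y z := by
  rw [inner_sub_left, real_inner_smul_left]

theorem inner_solidStress_grad (L₁ L₂ : ℝ) (η w : H1Zero Ω Γ) :
    inner ℝ (solidStress L₁ L₂ η) (grad w) =
      2 * L₁ * inner ℝ (epsL η) (epsL w) + L₂ * inner ℝ (dvgL η) (dvgL w) := by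
  refine (inner_smul_add_smul_left _ _ _ _ _).trans (congrArg₂ _ (congrArg _ ?_) (congrArg _ ?_))
  · exact inner_eps_grad η w
  · exact inner_iso_grad _ w

/-- `iso` is adjoint to `tr`, so the pressure sees the test field only through its divergence. -/
theorem inner_fluidStress_grad (μ : ℝ) (u w : H1Zero Ω Γ) (p : L2 Ω ℝ) (hw : dvgL w = 0) :
    inner ℝ (fluidStress μ u p) (grad w) = 2 * μ * inner ℝ (epsL u) (epsL w) := by
  have h1 : inner ℝ ((iso d).compLp p) (grad w) = 0 := by
    rw [inner_iso_grad, hw, inner_zero_right]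
  refine (inner_smul_sub_left _ _ _ _).trans ?_
  rw [h1, sub_zero]
  exact congrArg _ (inner_eps_grad u w)

/-- The space is closed in a complete one. Completeness lets Bochner integrals of `U` in time
commute with bounded maps, so they can serve as test fields. -/
instance H1Zero.instCompleteSpace : CompleteSpace (H1Zero Ω Γ) := by
  have hc : IsClosed ((H1Zero Ω Γ : Submodule ℝ (Ambient Ω Γ)) : Set (Ambient Ω Γ)) := by
    have h1 : IsClosed ((H1 Ω Γ : Submodule ℝ (Ambient Ω Γ)) : Set (Ambient Ω Γ)) :=
      (smoothFields Ω Γ).isClosed_topologicalClosure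
    have h2 : IsClosed {w : Ambient Ω Γ | w.2.2.2 = 0} :=
      isClosed_eq (by fun_prop) continuous_const
    exact h1.inter h2
  exact hc.completeSpace_coe

end Fields

/-! ### Window integrals under linear maps and inner products -/

section WindowMaps

variable {X Y : Type*} [NormedAddCommGroup X] [NormedSpace ℝ X] [NormedAddCommGroup Y]

theorem intervalIntegrable_of_integrableOn_Icc {f : ℝ → Y} {a b x y : ℝ}
    (hf : IntegrableOn f (Icc a b)) (hx : x ∈ Icc a b) (hy : y ∈ Icc a b) :
    IntervalIntegrable f volume x y :=
  (hf.mono_set (uIcc_subset_Icc hx hy)).intervalIntegrable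

theorem apply_windowIntegral [NormedSpace ℝ Y] [CompleteSpace X]
    [CompleteSpace Y] (L : X →L[ℝ] Y) {f : ℝ → X} {a b h t : ℝ} (hf : IntegrableOn f (Icc a b))
    (hh : 0 ≤ h) (ht : t ∈ Icc a (b - h)) :
    L (windowIntegral f h t) = windowIntegral (fun s => L (f s)) h t :=
  (L.intervalIntegral_comp_comm (intervalIntegrable_of_integrableOn_Icc hf
    ⟨ht.1, by linarith [ht.2]⟩ ⟨by linarith [ht.1], by linarith [ht.2]⟩)).symm

theorem windowIntegral_inner_const [InnerProductSpace ℝ Y] [CompleteSpace Y] {f : ℝ → Y}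
    {a b h t : ℝ}
    (hf : IntegrableOn f (Icc a b)) (hh : 0 ≤ h) (ht : t ∈ Icc a (b - h)) (y : Y) :
    windowIntegral (fun s => inner ℝ (f s) y) h t = inner ℝ (windowIntegral f h t) y := by
  have := apply_windowIntegral (innerSL ℝ y) hf hh ht
  simp only [innerSL_apply_apply] at this
  rw [real_inner_comm, this]
  simp only [real_inner_comm]

theorem integral_sub_eq_windowIntegral {f : ℝ → X} {a b h t : ℝ}
    (hf : IntegrableOn f (Icc a b)) (hh : 0 ≤ h) (ht : t ∈ Icc a (b - h)) :
    (∫ s in a..t + h, f s) - ∫ s in a..t, f s = windowIntegral f h t := by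
  have ha : a ∈ Icc a b := ⟨le_rfl, by linarith [ht.1, ht.2]⟩
  exact intervalIntegral.integral_interval_sub_left
    (intervalIntegrable_of_integrableOn_Icc hf ha ⟨by linarith [ht.1], by linarith [ht.2]⟩)
    (intervalIntegrable_of_integrableOn_Icc hf ha ⟨ht.1, by linarith [ht.2]⟩)

theorem windowIntegral_congr_ae {f g : ℝ → X} {a b h t : ℝ}
    (hfg : f =ᵐ[volume.restrict (Icc a b)] g) (hh : 0 ≤ h) (ht : t ∈ Icc a (b - h)) :
    windowIntegral f h t = windowIntegral g h t := by
  refine intervalIntegral.integral_congr_ae_restrict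
    (ae_restrict_of_ae_restrict_of_subset (fun s hs => ?_) hfg)
  rw [uIoc_of_le (by linarith)] at hs
  exact ⟨ht.1.trans hs.1.le, hs.2.trans (by linarith [ht.2])⟩

variable [InnerProductSpace ℝ Y]

theorem intervalIntegrable_inner_windowIntegral {F G : ℝ → Y} {a b h : ℝ}
    (hF : IntegrableOn F (Icc a b)) (hG : IntegrableOn G (Icc a b)) (hh : 0 ≤ h)
    (hb : a ≤ b - h) :
    IntervalIntegrable (fun t => inner ℝ (windowIntegral F h t) (windowIntegral G h t))
      volume a (b - h) :=
  ContinuousOn.intervalIntegrable (by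
    rw [uIcc_of_le hb]
    exact (continuousOn_windowIntegral hF hh).inner (continuousOn_windowIntegral hG hh))

theorem intervalIntegrable_inner_sub_windowIntegral {f : ℝ → Y} {a b h : ℝ}
    (hf : ContinuousOn f (Icc a b)) (hh : 0 ≤ h) (hb : a ≤ b - h) :
    IntervalIntegrable (fun t => inner ℝ (f (t + h) - f t) (windowIntegral f h t))
      volume a (b - h) :=
  ContinuousOn.intervalIntegrable (by
    rw [uIcc_of_le hb]
    refine ContinuousOn.inner (ContinuousOn.sub ?_ (hf.mono (Icc_subset_Icc_right (by linarith))))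
      (continuousOn_windowIntegral hf.integrableOn_Icc hh)
    exact hf.comp (by fun_prop) fun t ht => ⟨by linarith [ht.1], by linarith [ht.2]⟩)

end WindowMaps

/-! ### Abstract energy identities -/

section EnergyIdentities

variable {V H E Q S : Type*} [NormedAddCommGroup V] [NormedSpace ℝ V] [CompleteSpace V]
  [NormedAddCommGroup H] [InnerProductSpace ℝ H] [CompleteSpace H]
  [NormedAddCommGroup E] [InnerProductSpace ℝ E] [CompleteSpace E]
  [NormedAddCommGroup Q] [InnerProductSpace ℝ Q] [CompleteSpace Q]
  [NormedAddCommGroup S] [InnerProductSpace ℝ S] [CompleteSpace S]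
  (val : V →L[ℝ] H) (eps : V →L[ℝ] E) (dvg : V →L[ℝ] Q) (trace : V →L[ℝ] S)

/-- The energy identity of a linear parabolic problem with the linear constraint `dvg U = 0`. -/
theorem energy_identity_parabolic {ρ c a b : ℝ} {u : ℝ → H} {U : ℝ → V} {τ : ℝ → S}
    (hab : a < b) (hu : ContinuousOn u (Icc a b)) (mU : MemLp U 2 (volume.restrict (Icc a b)))
    (hUu : ∀ᵐ t ∂(volume.restrict (Icc a b)), val (U t) = u t)
    (hdvg : ∀ᵐ t ∂(volume.restrict (Icc a b)), dvg (U t) = 0)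
    (mτ : MemLp τ 2 (volume.restrict (Icc a b)))
    (momentum : ∀ w : V, dvg w = 0 → ∀ t ∈ Icc a b, ρ * inner ℝ (u t - u a) (val w) +
      (∫ s in a..t, c * inner ℝ (eps (U s)) (eps w)) = ∫ s in a..t, inner ℝ (τ s) (trace w)) :
    ρ * (1 / 2 * ‖u b‖ ^ 2 - 1 / 2 * ‖u a‖ ^ 2) + c * (∫ s in a..b, ‖eps (U s)‖ ^ 2) =
      ∫ s in a..b, inner ℝ (τ s) (trace (U s)) := by
  have mE : MemLp (fun s => eps (U s)) 2 (volume.restrict (Icc a b)) := eps.comp_memLp' mU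
  have mT : MemLp (fun s => trace (U s)) 2 (volume.restrict (Icc a b)) := trace.comp_memLp' mU
  have iU : IntegrableOn U (Icc a b) := mU.integrable (by norm_num)
  have iE : IntegrableOn (fun s => eps (U s)) (Icc a b) := mE.integrable (by norm_num)
  have iT : IntegrableOn (fun s => trace (U s)) (Icc a b) := mT.integrable (by norm_num)
  have iτ : IntegrableOn τ (Icc a b) := mτ.integrable (by norm_num)
  have l1 := tendsto_integral_inner_sub_windowIntegral hab hu
  have l2 := tendsto_integral_inner_windowIntegral hab mE mE
  have l3 := tendsto_integral_inner_windowIntegral hab mτ mT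
  have lim := (l1.const_mul ρ).add (l2.const_mul c)
  simp only [real_inner_self_eq_norm_sq] at lim
  -- Both sides agree for every small `h > 0`, hence so do their limits.
  refine tendsto_nhds_unique (lim.congr' ?_) l3
  filter_upwards [Ioo_mem_nhdsGT (sub_pos.2 hab)] with h hh
  have hb : a ≤ b - h := by linarith [hh.2]
  simp only [← real_inner_self_eq_norm_sq]
  rw [mul_left_comm, mul_left_comm c, ← mul_add, ← intervalIntegral.integral_const_mul,
    ← intervalIntegral.integral_const_mul, ← intervalIntegral.integral_add
      ((intervalIntegrable_inner_sub_windowIntegral hu hh.1.le hb).const_mul _)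
      ((intervalIntegrable_inner_windowIntegral iE iE hh.1.le hb).const_mul _)]
  congr 1
  refine intervalIntegral.integral_congr fun t ht => ?_
  rw [uIcc_of_le hb] at ht
  -- The test field is frozen for each `t`; it inherits the constraint `dvg w = 0` from almost every
  -- `U s`.
  set w := windowIntegral U h t with hw
  have t0 : t ∈ Icc a b := ⟨ht.1, by linarith [ht.2, hh.1]⟩
  have t1 : t + h ∈ Icc a b := ⟨by linarith [ht.1, hh.1], by linarith [ht.2]⟩
  have wv : val w = windowIntegral u h t := by
    rw [hw, apply_windowIntegral _ iU hh.1.le ht]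
    exact windowIntegral_congr_ae hUu hh.1.le ht
  have wd : dvg w = 0 := by
    rw [hw, apply_windowIntegral _ iU hh.1.le ht,
      windowIntegral_congr_ae (g := fun _ => 0) hdvg hh.1.le ht]
    simp [windowIntegral]
  have we : eps w = windowIntegral (fun s => eps (U s)) h t :=
    apply_windowIntegral _ iU hh.1.le ht
  have wt : trace w = windowIntegral (fun s => trace (U s)) h t :=
    apply_windowIntegral trace iU hh.1.le ht
  have m1 := momentum w wd (t + h) t1
  have m0 := momentum w wd t t0
  simp only [intervalIntegral.integral_const_mul] at m0 m1
  have dE := integral_sub_eq_windowIntegral (iE.inner_const (𝕜 := ℝ) (eps w)) hh.1.le ht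
  have dτ := integral_sub_eq_windowIntegral (iτ.inner_const (𝕜 := ℝ) (trace w)) hh.1.le ht
  rw [windowIntegral_inner_const iE hh.1.le ht] at dE
  rw [windowIntegral_inner_const iτ hh.1.le ht] at dτ
  rw [← wv, ← wt, ← dτ, ← m0, ← m1, ← we]
  rw [← we] at dE
  rw [← dE, inner_sub_left, inner_sub_left, inner_sub_left]
  ring

omit [CompleteSpace V] in
/-- The energy identity of a linear second-order evolution problem whose energy is
`c₁ ‖eps η‖² / 2 + c₂ ‖dvg η‖² / 2`. -/
theorem energy_identity_hyperbolic {ρ c₁ c₂ a b : ℝ} {η : ℝ → V} {v : ℝ → H} {vΓ τ : ℝ → S}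
    (hab : a < b) (hη : ContinuousOn η (Icc a b)) (hv : ContinuousOn v (Icc a b))
    (velocity : ∀ t ∈ Icc a b, HasDerivWithinAt (fun s => val (η s)) (v t) (Icc a b) t)
    (mv : MemLp vΓ 2 (volume.restrict (Icc a b)))
    (velocity_trace : ∀ t ∈ Icc a b, trace (η t) - trace (η a) = ∫ s in a..t, vΓ s)
    (mτ : MemLp τ 2 (volume.restrict (Icc a b)))
    (momentum : ∀ w : V, ∀ t ∈ Icc a b, ρ * inner ℝ (v t - v a) (val w) +
      (∫ s in a..t, (c₁ * inner ℝ (eps (η s)) (eps w) + c₂ * inner ℝ (dvg (η s)) (dvg w))) =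
        ∫ s in a..t, inner ℝ (τ s) (trace w)) :
    ρ * (1 / 2 * ‖v b‖ ^ 2 - 1 / 2 * ‖v a‖ ^ 2) +
        (c₁ * (1 / 2 * ‖eps (η b)‖ ^ 2 - 1 / 2 * ‖eps (η a)‖ ^ 2) +
          c₂ * (1 / 2 * ‖dvg (η b)‖ ^ 2 - 1 / 2 * ‖dvg (η a)‖ ^ 2)) =
      ∫ s in a..b, inner ℝ (τ s) (vΓ s) := by
  have cE : ContinuousOn (fun s => eps (η s)) (Icc a b) :=
    eps.continuous.comp_continuousOn hη
  have cD : ContinuousOn (fun s => dvg (η s)) (Icc a b) :=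
    dvg.continuous.comp_continuousOn hη
  have iE := cE.integrableOn_Icc (μ := volume)
  have iD := cD.integrableOn_Icc (μ := volume)
  have iτ : IntegrableOn τ (Icc a b) := mτ.integrable (by norm_num)
  have iv : IntegrableOn vΓ (Icc a b) := mv.integrable (by norm_num)
  have l1 := tendsto_integral_inner_sub_windowIntegral hab hv
  -- Unlike the viscous term, the elastic terms telescope: the test field is an increment of `η`,
  -- paired with window integrals of `eps η` and `dvg η`.
  have l2 := tendsto_integral_inner_sub_windowIntegral hab cE
  have l3 := tendsto_integral_inner_sub_windowIntegral hab cD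
  have l4 := tendsto_integral_inner_windowIntegral hab mτ mv
  have lim := (l1.const_mul ρ).add ((l2.const_mul c₁).add (l3.const_mul c₂))
  refine tendsto_nhds_unique (lim.congr' ?_) l4
  filter_upwards [Ioo_mem_nhdsGT (sub_pos.2 hab)] with h hh
  have hb : a ≤ b - h := by linarith [hh.2]
  have j1 := (intervalIntegrable_inner_sub_windowIntegral hv hh.1.le hb).const_mul
    ρ
  have j2 := (intervalIntegrable_inner_sub_windowIntegral cE hh.1.le hb).const_mul c₁
  have j3 := (intervalIntegrable_inner_sub_windowIntegral cD hh.1.le hb).const_mul c₂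
  rw [mul_left_comm ρ, mul_left_comm c₁, mul_left_comm c₂, ← mul_add, ← mul_add,
    ← intervalIntegral.integral_const_mul,
    ← intervalIntegral.integral_const_mul, ← intervalIntegral.integral_const_mul,
    ← intervalIntegral.integral_add j2 j3, ← intervalIntegral.integral_add j1 (j2.add j3)]
  congr 1
  refine intervalIntegral.integral_congr fun t ht => ?_
  rw [uIcc_of_le hb] at ht
  -- This replaces the window integral of `v`, which is not known to lie in `V`; its value and trace
  -- are the window integrals of `v` and `vΓ`.
  set w := η (t + h) - η t with hw
  have t0 : t ∈ Icc a b := ⟨ht.1, by linarith [ht.2, hh.1]⟩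
  have t1 : t + h ∈ Icc a b := ⟨by linarith [ht.1, hh.1], by linarith [ht.2]⟩
  have wv : val w = windowIntegral v h t := by
    have := intervalIntegral.integral_eq_sub_of_hasDeriv_right
      (f := fun s => val (η s)) (f' := v) (a := t) (b := t + h) ?_ ?_ ?_
    · rw [windowIntegral, this]
      exact map_sub val _ _
    · rw [uIcc_of_le (by linarith [hh.1])]
      exact (val.continuous.comp_continuousOn hη).mono
        (Icc_subset_Icc t0.1 t1.2)
    · intro s hs
      rw [min_eq_left (by linarith [hh.1]), max_eq_right (by linarith [hh.1])] at hs
      have hs' : s ∈ Ioo a b := ⟨t0.1.trans_lt hs.1, hs.2.trans_le t1.2⟩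
      exact ((velocity s (Ioo_subset_Icc_self hs')).hasDerivAt
        (Icc_mem_nhds hs'.1 hs'.2)).hasDerivWithinAt
    · exact intervalIntegrable_of_integrableOn_Icc hv.integrableOn_Icc t0 t1
  have wt : trace w = windowIntegral vΓ h t := by
    rw [← integral_sub_eq_windowIntegral iv hh.1.le ht, ← velocity_trace t t0,
      ← velocity_trace (t + h) t1, sub_sub_sub_cancel_right]
    exact map_sub trace _ _
  have we : eps w = eps (η (t + h)) - eps (η t) := map_sub _ _ _
  have wd : dvg w = dvg (η (t + h)) - dvg (η t) := map_sub _ _ _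
  have iσ : IntegrableOn (fun s => c₁ * inner ℝ (eps (η s)) (eps w) + c₂ * inner ℝ (dvg (η s)) (dvg w)) (Icc a b) := by
    exact ((iE.inner_const (𝕜 := ℝ) (eps w)).const_mul _).add
      ((iD.inner_const (𝕜 := ℝ) (dvg w)).const_mul _)
  have dσ := integral_sub_eq_windowIntegral iσ hh.1.le ht
  have eσ : windowIntegral (fun s => c₁ * inner ℝ (eps (η s)) (eps w) + c₂ * inner ℝ (dvg (η s)) (dvg w)) h t =
      c₁ * inner ℝ (windowIntegral (fun s => eps (η s)) h t) (eps w) +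
        c₂ * inner ℝ (windowIntegral (fun s => dvg (η s)) h t) (dvg w) := by
    rw [← windowIntegral_inner_const iE hh.1.le ht, ← windowIntegral_inner_const iD hh.1.le ht]
    simp only [windowIntegral]
    rw [intervalIntegral.integral_add, intervalIntegral.integral_const_mul,
      intervalIntegral.integral_const_mul]
    · exact (intervalIntegrable_of_integrableOn_Icc (iE.inner_const (𝕜 := ℝ) (eps w))
        t0 t1).const_mul _
    · exact (intervalIntegrable_of_integrableOn_Icc (iD.inner_const (𝕜 := ℝ) (dvg w))
        t0 t1).const_mul _
  have dτ := integral_sub_eq_windowIntegral (iτ.inner_const (𝕜 := ℝ) (trace w)) hh.1.le ht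
  rw [windowIntegral_inner_const iτ hh.1.le ht] at dτ
  have m1 := momentum w (t + h) t1
  have m0 := momentum w t t0
  rw [← wv, ← wt, ← we, ← wd, ← dτ, ← m0, ← m1]
  rw [real_inner_comm _ (eps w), real_inner_comm _ (dvg w), ← eσ, ← dσ]
  simp only [inner_sub_left]
  ring

end EnergyIdentities

/-! ### Energy identities of the two subproblems -/

section Slab

variable {d : ℕ} {Ω Γ : Set (Vec d)}

/-- Only divergence-free test fields enter, so the pressure drops out before any limit in time is
taken. -/
theorem IsFluidSolution.energy_identity {ρf μ lam a b : ℝ} {vΓ : ℝ → L2Surf Γ}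
    {tauTilde : L2Surf Γ} {ua : L2 Ω (Vec d)} {u : ℝ → L2 Ω (Vec d)} {U : ℝ → H1Zero Ω Γ}
    {p : ℝ → L2 Ω ℝ} {τ : ℝ → L2Surf Γ} (hab : a < b)
    (H : IsFluidSolution ρf μ lam a b vΓ tauTilde ua u U p τ) :
    ρf * (1 / 2 * ‖u b‖ ^ 2 - 1 / 2 * ‖u a‖ ^ 2) + 2 * μ * (∫ s in a..b, ‖eps (U s)‖ ^ 2) =
      ∫ s in a..b, inner ℝ (τ s) (trace (U s)) := by
  refine energy_identity_parabolic valL epsL dvgL traceL hab H.continuous_velocity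
    H.memLp_velocity H.velocity_eq H.incompressible H.memLp_traction fun w hw t ht => ?_
  have h := H.momentum w t ht
  simp only [inner_fluidStress_grad μ _ w _ hw] at h
  exact h

theorem IsSolidSolution.energy_identity {ρs L₁ L₂ lam a b : ℝ} {uTilde tauTilde : L2Surf Γ}
    {ηa : H1Zero Ω Γ} {va : L2 Ω (Vec d)} {η : ℝ → H1Zero Ω Γ} {v : ℝ → L2 Ω (Vec d)}
    {vΓ τ : ℝ → L2Surf Γ} (hab : a < b)
    (H : IsSolidSolution ρs L₁ L₂ lam a b uTilde tauTilde ηa va η v vΓ τ) :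
    ρs * (1 / 2 * ‖v b‖ ^ 2 - 1 / 2 * ‖v a‖ ^ 2) +
        (1 / 2 * elasticNormSq L₁ L₂ (η b) - 1 / 2 * elasticNormSq L₁ L₂ (η a)) =
      ∫ s in a..b, inner ℝ (τ s) (vΓ s) := by
  have h := energy_identity_hyperbolic valL epsL dvgL traceL hab H.continuous_displacement
    H.continuous_velocity H.velocity H.memLp_velocity_trace H.velocity_trace H.memLp_traction
    (ρ := ρs) (c₁ := 2 * L₁) (c₂ := L₂) fun w t ht => by
      have h := H.momentum w t ht
      simp only [inner_solidStress_grad] at h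
      exact h
  rw [← h]
  simp only [elasticNormSq, epsL_apply, dvgL_apply]
  ring

end Slab

/-! ### Jensen's inequality and the Robin conditions -/

section Interface

variable {X : Type*} [NormedAddCommGroup X]

theorem intervalIntegrable_norm_sq {f : ℝ → X} {a b : ℝ} (hab : a ≤ b)
    (hf : MemLp f 2 (volume.restrict (Icc a b))) :
    IntervalIntegrable (fun t => ‖f t‖ ^ 2) volume a b := by
  have h : IntegrableOn (fun t => ‖f t‖ ^ 2) (Icc a b) := hf.integrable_norm_pow (by norm_num)
  exact intervalIntegrable_of_integrableOn_Icc h ⟨le_rfl, hab⟩ ⟨hab, le_rfl⟩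

variable [InnerProductSpace ℝ X]

theorem intervalIntegrable_inner {f g : ℝ → X} {a b : ℝ} (hab : a ≤ b)
    (hf : MemLp f 2 (volume.restrict (Icc a b))) (hg : MemLp g 2 (volume.restrict (Icc a b))) :
    IntervalIntegrable (fun t => inner ℝ (f t) (g t)) volume a b := by
  have e : (fun t => inner ℝ (f t) (g t)) =
      fun t => (‖f t + g t‖ ^ 2 - ‖f t‖ ^ 2 - ‖g t‖ ^ 2) / 2 := by
    funext t
    rw [norm_add_sq_real]
    ring
  rw [e]
  exact (((intervalIntegrable_norm_sq hab (hf.add hg)).sub (intervalIntegrable_norm_sq hab hf)).sub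
    (intervalIntegrable_norm_sq hab hg)).div_const 2

/-- Jensen's inequality for the square of the norm of a time average. -/
theorem mul_norm_average_sq_le [CompleteSpace X] {f : ℝ → X} {a b : ℝ} (hab : a < b)
    (hf : MemLp f 2 (volume.restrict (Icc a b))) :
    (b - a) * ‖(1 / (b - a)) • ∫ s in a..b, f s‖ ^ 2 ≤ ∫ s in a..b, ‖f s‖ ^ 2 := by
  set m := (1 / (b - a)) • ∫ s in a..b, f s with hm
  have hi : IntegrableOn f (Icc a b) := hf.integrable (by norm_num)
  have hba : 0 < b - a := sub_pos.2 hab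
  have i1 := intervalIntegrable_norm_sq hab.le hf
  have i2 : IntervalIntegrable (fun t => inner ℝ (f t) m) volume a b :=
    intervalIntegrable_inner hab.le hf (memLp_const m)
  have e1 : ∫ s in a..b, inner ℝ (f s) m = (b - a) * ‖m‖ ^ 2 := by
    have := windowIntegral_inner_const (t := a) (h := b - a) hi hba.le
      ⟨le_rfl, by linarith⟩ m
    simp only [windowIntegral, add_sub_cancel] at this
    rw [this]
    have : ∫ s in a..b, f s = (b - a) • m := by
      rw [hm, smul_smul, mul_one_div_cancel hba.ne', one_smul]
    rw [this, real_inner_smul_left, real_inner_self_eq_norm_sq]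
  -- Jensen follows from nonnegativity of this variance about the mean.
  have e2 : ∫ s in a..b, ‖f s - m‖ ^ 2 = (∫ s in a..b, ‖f s‖ ^ 2) - (b - a) * ‖m‖ ^ 2 := by
    simp only [norm_sub_sq_real]
    rw [intervalIntegral.integral_add (i1.sub (i2.const_mul 2)) (by simp),
      intervalIntegral.integral_sub i1 (i2.const_mul 2), intervalIntegral.integral_const_mul, e1,
      intervalIntegral.integral_const, smul_eq_mul]
    ring
  have : 0 ≤ ∫ s in a..b, ‖f s - m‖ ^ 2 :=
    intervalIntegral.integral_nonneg hab.le fun _ _ => by positivity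
  linarith

/-- The pointwise interface identity given by the two Robin conditions. -/
theorem robin_identity {lam : ℝ} (hlam : 0 < lam) {v ts U tf u₀ t₀ : X}
    (hs : lam • v + ts = lam • u₀ - t₀) (hf : lam • U + tf = lam • v + t₀) :
    inner ℝ ts v + inner ℝ tf U + (lam / 2 * ‖v - u₀‖ ^ 2 +
        (1 / (2 * lam) * ‖tf‖ ^ 2 + lam / 2 * ‖U‖ ^ 2)) =
      lam / 2 * ‖u₀‖ ^ 2 + 1 / (2 * lam) * ‖t₀‖ ^ 2 := by
  have e1 : ts = lam • u₀ - t₀ - lam • v := by rw [← hs]; abel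
  -- Squaring the fluid condition produces `2 lam ⟪U, tf⟫`, the fluid power up to the factor `2
  -- lam`; its term in `⟪v, t₀⟫` cancels the one in the solid power.
  have e2 := congrArg (fun x => ‖x‖ ^ 2) hf
  simp only [norm_add_sq_real, norm_smul, mul_pow, real_inner_smul_left, Real.norm_eq_abs,
    sq_abs] at e2
  rw [e1, inner_sub_left, inner_sub_left, real_inner_smul_left, real_inner_smul_left,
    real_inner_self_eq_norm_sq, norm_sub_sq_real, real_inner_comm u₀ v, real_inner_comm U tf]
  rw [real_inner_comm t₀ v] at e2
  field_simp
  linarith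

end Interface

/-! ### One step of the splitting scheme -/

section Step

variable {d : ℕ} {Ωs Ωf : Set (Vec d)} {I : Iterates Ωs Ωf} {P : Params} {N : ℕ}

theorem Params.t_lt_succ (P : Params) (n : ℕ) : P.t n < P.t (n + 1) := by
  have := P.dt_pos
  simp only [Params.t]
  push_cast
  linarith

theorem Params.t_succ_sub (P : Params) (n : ℕ) : P.t (n + 1) - P.t n = P.dt := by
  simp only [Params.t]
  push_cast
  ring

/-- Jensen for both interface averages; for `n = 0` the data are not averaged and equality holds. -/
theorem Iterates.IsSolution.averages_le_interfaceTerm (hI : I.IsSolution P N) {n : ℕ}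
    (hn : n ≤ N) :
    P.dt * (P.lam / 2 * ‖I.uTilde P n‖ ^ 2 + 1 / (2 * P.lam) * ‖I.tauTilde P n‖ ^ 2) ≤
      I.interfaceTerm P n := by
  have hl := P.lam_pos
  cases n with
  | zero =>
    simp only [Iterates.uTilde, Iterates.tauTilde, Iterates.interfaceTerm]
    refine le_of_eq ?_
    ring
  | succ n =>
    have hF := hI.fluid n hn
    have j1 := mul_norm_average_sq_le (P.t_lt_succ n) (traceL.comp_memLp' hF.memLp_velocity)
    have j2 := mul_norm_average_sq_le (P.t_lt_succ n) hF.memLp_traction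
    rw [P.t_succ_sub] at j1 j2
    have k1 := mul_le_mul_of_nonneg_left j1 (show 0 ≤ P.lam / 2 by positivity)
    have k2 := mul_le_mul_of_nonneg_left j2 (show 0 ≤ 1 / (2 * P.lam) by positivity)
    simp only [Function.comp_apply, traceL_apply] at k1
    simp only [Iterates.uTilde, Iterates.tauTilde, Iterates.interfaceTerm]
    linarith

/-- The energy balance over one time slab. -/
theorem Iterates.IsSolution.energy_succ (hI : I.IsSolution P N) {n : ℕ} (hn : n < N) :
    I.energy P (n + 1) + I.dissipationSucc P n + I.interfaceTerm P (n + 1) =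
      I.energy P n +
        P.dt * (P.lam / 2 * ‖I.uTilde P n‖ ^ 2 + 1 / (2 * P.lam) * ‖I.tauTilde P n‖ ^ 2) := by
  have hF := hI.fluid n hn
  have hS := hI.solid n hn
  have hab := P.t_lt_succ n
  have eF := hF.energy_identity hab
  have eS := hS.energy_identity hab
  -- The initial state is the end state of the previous slab, which is what makes the energies
  -- telescope.
  rw [hF.initial_velocity] at eF
  rw [hS.initial_velocity, hS.initial_displacement] at eS
  have mT : MemLp (fun s => trace (I.U (n + 1) s)) 2
      (volume.restrict (Icc (P.t n) (P.t (n + 1)))) := traceL.comp_memLp' hF.memLp_velocity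
  have i1 := intervalIntegrable_inner hab.le hS.memLp_traction hS.memLp_velocity_trace
  have i2 := intervalIntegrable_inner hab.le hF.memLp_traction mT
  have mv : MemLp (fun s => I.vΓ (n + 1) s - I.uTilde P n) 2
      (volume.restrict (Icc (P.t n) (P.t (n + 1)))) :=
    hS.memLp_velocity_trace.sub (memLp_const (I.uTilde P n))
  have i3 := (intervalIntegrable_norm_sq hab.le mv).const_mul (P.lam / 2)
  have i4 := (intervalIntegrable_norm_sq hab.le hF.memLp_traction).const_mul (1 / (2 * P.lam))
  have i5 := (intervalIntegrable_norm_sq hab.le mT).const_mul (P.lam / 2)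
  -- The averaged data are constant on the slab, so the right side integrates to a factor `dt`.
  have key := intervalIntegral.integral_congr_ae_restrict (μ := volume) (a := P.t n)
    (b := P.t (n + 1))
    (f := fun s => inner ℝ (I.τs (n + 1) s) (I.vΓ (n + 1) s) +
      inner ℝ (I.τf (n + 1) s) (trace (I.U (n + 1) s)) +
      (P.lam / 2 * ‖I.vΓ (n + 1) s - I.uTilde P n‖ ^ 2 +
        (1 / (2 * P.lam) * ‖I.τf (n + 1) s‖ ^ 2 + P.lam / 2 * ‖trace (I.U (n + 1) s)‖ ^ 2)))
    (g := fun _ => P.lam / 2 * ‖I.uTilde P n‖ ^ 2 + 1 / (2 * P.lam) * ‖I.tauTilde P n‖ ^ 2) (by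
      have hsub : uIoc (P.t n) (P.t (n + 1)) ⊆ Icc (P.t n) (P.t (n + 1)) := by
        rw [uIoc_of_le hab.le]
        exact Ioc_subset_Icc_self
      filter_upwards [ae_restrict_of_ae_restrict_of_subset hsub hS.robin,
        ae_restrict_of_ae_restrict_of_subset hsub hF.robin] with s h1 h2
      exact robin_identity P.lam_pos h1 h2)
  rw [intervalIntegral.integral_add (i1.add i2) (i3.add (i4.add i5)),
    intervalIntegral.integral_add i1 i2, intervalIntegral.integral_add i3 (i4.add i5),
    intervalIntegral.integral_add i4 i5, intervalIntegral.integral_const_mul,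
    intervalIntegral.integral_const_mul, intervalIntegral.integral_const_mul,
    intervalIntegral.integral_const, P.t_succ_sub, smul_eq_mul, ← eF, ← eS] at key
  simp only [Iterates.energy, Iterates.dissipationSucc, Iterates.interfaceTerm]
  linarith

end Step

end
end RobinFSI

theorem theorem1 {d : ℕ} (hd : 1 ≤ d) (Ωs Ωf : Set (RobinFSI.Vec d))
    (hΩs : RobinFSI.IsLipschitzDomain Ωs) (hΩf : RobinFSI.IsLipschitzDomain Ωf)
    (P : RobinFSI.Params) (N : ℕ) (I : RobinFSI.Iterates Ωs Ωf) (hI : I.IsSolution P N) :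
    I.energy P N + (∑ n ∈ Finset.range N, I.dissipationSucc P n) + I.interfaceTerm P N ≤
      I.energy P 0 + I.interfaceTerm P 0 := by
  -- The interface term stays on the left: it pays for the averaged data of the next slab.
  suffices H : ∀ M ≤ N, I.energy P M + (∑ n ∈ Finset.range M, I.dissipationSucc P n) +
      I.interfaceTerm P M ≤ I.energy P 0 + I.interfaceTerm P 0 from H N le_rfl
  intro M
  induction M with
  | zero => simp
  | succ M ih =>
    intro hM
    have h1 := hI.energy_succ hM
    have h2 := hI.averages_le_interfaceTerm (Nat.le_of_lt hM)
    have h3 := ih (Nat.le_of_lt hM)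
    rw [Finset.sum_range_succ]
    linarith
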